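/- Write $\mathbb H$ for the real quaternions with modulus $|\cdot|_Q$. For integrable $f:\mathbb R^2\to\mathbb H$ the two-sided quaternion Fourier transform is $$\mathcal F\{f\}(y)=\int_{\mathbb R^2}e^{-2\pi i\,y_1x_1}\,f(x)\,e^{-2\pi j\,y_2x_2}\,dx ,$$ and, for $f=f_0+if_1+jf_2+kf_3$ with real-valued $f_m$, $$\|\mathcal F\{f\}(y)\|_Q:=\Big(\sum_{m=0}^{3}|\mathcal F\{f_m\}(y)|_Q^2\Big)^{1/2}.$$ **Corollary 5.1 (Hardy type).** Let $d\ge 0$ and $\alpha,\beta>0$ be real numbers. Consider the following condition on $f\in L^2(\mathbb R^2,\mathbb H)$: there is a constant $C>0$ such that $$|f(x)|_Q\le C(1+|x|)^d e^{-\pi\alpha|x|^2},\qquad \|\mathcal F\{f\}(y)\|_Q\le C(1+|y|)^d e^{-\pi\beta|y|^2}\qquad(\ast)$$ for almost every $x\in\mathbb R^2$ and almost every $y\in\mathbb R^2$. (The first bound makes $f$ integrable, so $\mathcal F\{f\}$ is given by the integral above.) (i) If $\alpha\beta>1$ and $f$ satisfies $(\ast)$, then $f=0$ (in $L^2$). (ii)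 If $\alpha\beta=1$ and $f$ satisfies $(\ast)$, then $f(x)=P(x)e^{-\pi\alpha|x|^2}$ for almost every $x$, where $P=P_0+iP_1+jP_2+kP_3$, with $P_m\in\mathbb R[x_1,x_2]$, is a quaternion-valued polynomial of (total) degree at most $d$. (iii) If $\alpha\beta<1$, there is an infinite sequence of elements of $L^2(\mathbb R^2,\mathbb H)$, linearly independent over $\mathbb H$ acting by left multiplication (hence also over $\mathbb R$), each of which satisfies $(\ast)$ with some constant $C$. -/

import Mathlib

open MeasureTheory
open scoped Quaternion ENNReal

noncomputable section

namespace QFT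

/-- The plane `ℝ²` with its Euclidean norm `|x|` and Lebesgue measure. -/
abbrev Plane : Type := EuclideanSpace ℝ (Fin 2)

/-- The space `L²(ℝ², ℍ)`; its elements are classes of functions modulo equality a.e. -/
abbrev L2 : Type := Lp ℍ 2 (volume : Measure Plane)

/-- The imaginary unit `i` of the quaternions. -/
def qi : ℍ := ⟨0, 1, 0, 0⟩

/-- The imaginary unit `j` of the quaternions. -/
def qj : ℍ := ⟨0, 0, 1, 0⟩

/-- `e^{μ θ} = cos θ + μ sin θ` (Euler's formula), for a quaternion `μ` with `μ² = -1`. -/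
def eulerExp (μ : ℍ) (θ : ℝ) : ℍ := (Real.cos θ : ℍ) + μ * (Real.sin θ : ℍ)

/-- The two-sided quaternion Fourier transform
`𝓕{f}(ξ) = ∫ e^{-i 2π ξ₁ x₁} f(x) e^{-j 2π ξ₂ x₂} dx`. -/
def qft (f : Plane → ℍ) (ξ : Plane) : ℍ :=
  ∫ x : Plane, eulerExp qi (-(2 * Real.pi * ξ 0 * x 0)) * f x *
    eulerExp qj (-(2 * Real.pi * ξ 1 * x 1))

/-- The modulus `‖𝓕{f}(y)‖_Q = (∑ₘ |𝓕{fₘ}(y)|_Q²)^{1/2}`, where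
`f = f₀ + i f₁ + j f₂ + k f₃` with real-valued `fₘ`. -/
def qftModulus (f : Plane → ℍ) (y : Plane) : ℝ :=
  Real.sqrt
    (‖qft (fun x => ((f x).re : ℍ)) y‖ ^ 2 + ‖qft (fun x => ((f x).imI : ℍ)) y‖ ^ 2 +
      ‖qft (fun x => ((f x).imJ : ℍ)) y‖ ^ 2 + ‖qft (fun x => ((f x).imK : ℍ)) y‖ ^ 2)

/-- The decay conditions on `f` and on its transform. The first one makes `f` integrable when
`0 < α`, so that the integral defining the transform converges. -/
def HardyDecay (d α β : ℝ) (f : L2) : Prop :=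
  ∃ C : ℝ, 0 < C ∧
    (∀ᵐ x : Plane, ‖f x‖ ≤ C * (1 + ‖x‖) ^ d * Real.exp (-(Real.pi * α * ‖x‖ ^ 2))) ∧
    (∀ᵐ y : Plane, qftModulus f y ≤ C * (1 + ‖y‖) ^ d * Real.exp (-(Real.pi * β * ‖y‖ ^ 2)))

/-- Polynomials in two (central) real variables with quaternion coefficients:
`P = P₀ + i P₁ + j P₂ + k P₃` with `Pₘ ∈ ℝ[x₁, x₂]`. -/
abbrev QPoly : Type := Quaternion (MvPolynomial (Fin 2) ℝ)

/-- The value of a quaternion polynomial at a point of the plane. -/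
def QPoly.eval (P : QPoly) (x : Plane) : ℍ :=
  ⟨MvPolynomial.eval (fun i => x i) P.re, MvPolynomial.eval (fun i => x i) P.imI,
    MvPolynomial.eval (fun i => x i) P.imJ, MvPolynomial.eval (fun i => x i) P.imK⟩

/-- The (total) degree of a quaternion polynomial. -/
def QPoly.degree (P : QPoly) : ℕ :=
  max (max P.re.totalDegree P.imI.totalDegree) (max P.imJ.totalDegree P.imK.totalDegree)

end QFT

end

/-!
Let `u` be a real function and `û` its complex Fourier transform. If `‖f x‖` and the transform of
`f` are dominated as in `QFT.HardyDecay`, then so are each real component `u` of `f` and `û`, up to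
a factor `2`: for real `u` the squared modulus of `qft u` at `y = (y₁, y₂)` is the mean of
`|û(y₁, y₂)|²` and `|û(y₁, -y₂)|²` (`QFT.norm_sq_qft`). Everything then takes place for real
functions on the plane.

In the critical case `α * β = 1`, the transform of a function with Gaussian decay extends to an
entire function along every line `z ↦ ξ + z e`, and dividing it by the corresponding Gaussian leaves
an entire function `g` with `|g(z)| ≤ M (1 + |Im z|) ^ d exp (A (Re z)²)` that grows polynomially on
the real axis. By a Phragmén–Lindelöf argument `g` is a polynomial
(`QFT.exists_polynomial_of_growth`). This order two growth is critical for a quadrant, so the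
argument is carried out in sectors of opening `φ < π / 2`, with a multiplier that tends to `1` as
`φ → π / 2`. The result is `QFT.exists_polynomial_fourier_line`.

The roles of `u` and `û` are symmetric, since `u` is the transform of the inverse transform of `u`.
Hence `u` itself, divided by its Gaussian, is a polynomial on every line parallel to an axis, and
therefore a polynomial (`QFT.exists_ae_eq_gaussian_mul_polynomial`). Its degree is bounded because
its growth is. When `α * β > 1`, lowering `α` to `β⁻¹` reaches the critical case, and the excess
decay of `u` forces the polynomial to vanish. When `α * β < 1`, the Gaussians `e^{-πγ|x|²}` with
`α ≤ γ ≤ β⁻¹` satisfy both bounds, and Gaussians of distinct widths are independent.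
-/

namespace QFT

open Polynomial Filter Asymptotics Topology
open scoped FourierTransform RealInnerProductSpace

/-! ### Growth and interpolation of polynomials -/

theorem natDegree_le_of_abs_eval_le {p : ℝ[X]} (hp : p ≠ 0) {C e : ℝ}
    (h : ∀ t : ℝ, 0 ≤ t → |p.eval t| ≤ C * (1 + t) ^ e) : (p.natDegree : ℝ) ≤ e := by
  by_contra! hlt
  have h1 : (fun t : ℝ => t ^ p.natDegree) =O[atTop] fun t => p.eval t := by
    have h2 := p.isEquivalent_atTop_lead.isBigO_symm
    have h3 : (fun t : ℝ => t ^ p.natDegree) =O[atTop]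
        fun t => p.leadingCoeff * t ^ p.natDegree :=
      isBigO_self_const_mul (leadingCoeff_ne_zero.2 hp) _ _
    exact h3.trans h2
  have h2 : (fun t : ℝ => p.eval t) =O[atTop] fun t => (1 + t) ^ e := by
    refine IsBigO.of_bound C ?_
    filter_upwards [eventually_ge_atTop 0] with t ht
    rw [Real.norm_eq_abs, Real.norm_of_nonneg (by positivity)]
    exact h t ht
  have h3 : (fun t : ℝ => (1 + t) ^ (p.natDegree : ℝ)) =O[atTop]
      fun t : ℝ => t ^ p.natDegree := by
    refine IsBigO.of_bound (2 ^ p.natDegree) ?_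
    filter_upwards [eventually_ge_atTop 1] with t ht
    rw [Real.rpow_natCast, Real.norm_of_nonneg (by positivity),
      Real.norm_of_nonneg (by positivity), ← mul_pow]
    gcongr
    linarith
  have h4 : Tendsto (fun t : ℝ => (1 + t) ^ ((p.natDegree : ℝ) - e)) atTop atTop :=
    (tendsto_rpow_atTop (sub_pos.2 hlt)).comp (tendsto_atTop_add_const_left _ 1 tendsto_id)
  obtain ⟨K, hK⟩ := (h3.trans (h1.trans h2)).bound
  obtain ⟨t, h5, h6, h7⟩ :=
    (hK.and ((h4.eventually_gt_atTop K).and (eventually_ge_atTop 0))).exists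
  have hpos : 0 < 1 + t := by linarith
  rw [Real.norm_of_nonneg (by positivity), Real.norm_of_nonneg (by positivity)] at h5
  rw [Real.rpow_sub hpos, lt_div_iff₀ (by positivity)] at h6
  linarith

theorem eval_mul_homogeneousComponent {σ : Type*} [Fintype σ] (P : MvPolynomial σ ℝ) (i : ℕ) (t : ℝ)
    (v : σ → ℝ) : MvPolynomial.eval (fun j => t * v j) (MvPolynomial.homogeneousComponent i P) =
      MvPolynomial.eval v (MvPolynomial.homogeneousComponent i P) * t ^ i := by
  rw [MvPolynomial.eval_eq', MvPolynomial.eval_eq', Finset.sum_mul]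
  refine Finset.sum_congr rfl fun s hs => ?_
  have hdeg : ∑ j, s j = i := by
    have := MvPolynomial.homogeneousComponent_isHomogeneous i P (MvPolynomial.mem_support_iff.1 hs)
    simpa [Finsupp.weight_apply, Finsupp.sum_fintype] using this
  simp_rw [mul_pow]
  rw [Finset.prod_mul_distrib, Finset.prod_pow_eq_pow_sum, hdeg]
  ring

/-- A nonzero polynomial dominated by `(1 + ‖x‖) ^ e` has total degree at most `e`, for every real
exponent `e`; in particular there is none if `e < 0`. The reason is the one-variable case on a line
through the origin on which the leading form does not vanish. -/
theorem totalDegree_le_of_abs_eval_le {n : ℕ} [NeZero n] {P : MvPolynomial (Fin n) ℝ} (hP : P ≠ 0)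
    {C e : ℝ} (h : ∀ x : EuclideanSpace ℝ (Fin n),
      |MvPolynomial.eval (fun i => x i) P| ≤ C * (1 + ‖x‖) ^ e) : (P.totalDegree : ℝ) ≤ e := by
  have htop : MvPolynomial.homogeneousComponent P.totalDegree P ≠ 0 := by
    obtain ⟨s, hs, hs'⟩ := Finset.exists_mem_eq_sup P.support
      (MvPolynomial.support_nonempty.2 hP) fun s => s.sum fun _ e => e
    intro h0
    have := congrArg (MvPolynomial.coeff s) h0
    rw [MvPolynomial.coeff_homogeneousComponent, if_pos] at this
    · exact (MvPolynomial.mem_support_iff.1 hs) (by simpa using this)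
    · rw [MvPolynomial.totalDegree, hs', Finsupp.degree_apply, Finsupp.sum]
  -- The factor `X 0` makes the direction `v` nonzero, which matters when `e < 0`.
  obtain ⟨v, hv⟩ : ∃ v : Fin n → ℝ, MvPolynomial.eval v
      (MvPolynomial.X 0 * MvPolynomial.homogeneousComponent P.totalDegree P) ≠ 0 := by
    by_contra! hall
    exact mul_ne_zero (MvPolynomial.X_ne_zero 0) htop
      (MvPolynomial.funext fun v => by rw [hall v, map_zero])
  rw [map_mul, MvPolynomial.eval_X] at hv
  have hv0 := left_ne_zero_of_mul hv
  replace hv := right_ne_zero_of_mul hv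
  let q : ℝ[X] := ∑ i ∈ Finset.range (P.totalDegree + 1),
    Polynomial.C (MvPolynomial.eval v (MvPolynomial.homogeneousComponent i P)) * X ^ i
  have hqc : q.coeff P.totalDegree ≠ 0 := by
    simpa [q, Polynomial.finsetSum_coeff, Polynomial.coeff_C_mul, Polynomial.coeff_X_pow] using hv
  have hq0 : q ≠ 0 := fun h0 => hqc (by simp [h0])
  have hqe : ∀ t : ℝ, q.eval t = MvPolynomial.eval (fun i => t * v i) P := by
    intro t
    conv_rhs => rw [← MvPolynomial.sum_homogeneousComponent P]
    simp only [q, Polynomial.eval_finsetSum, map_sum, Polynomial.eval_mul, Polynomial.eval_C,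
      Polynomial.eval_pow, Polynomial.eval_X, eval_mul_homogeneousComponent]
  have hdeg : P.totalDegree ≤ q.natDegree := le_natDegree_of_ne_zero hqc
  refine (Nat.cast_le.2 hdeg).trans ?_
  set x : EuclideanSpace ℝ (Fin n) := WithLp.toLp 2 v with hx
  have hx0 : 0 < ‖x‖ := norm_pos_iff.2 fun h0 => hv0 (by simpa [hx] using congrArg (fun y => y 0) h0)
  have hC0 : 0 ≤ C := by simpa using (abs_nonneg _).trans (h 0)
  have hqx : ∀ t : ℝ, 0 ≤ t → |q.eval t| ≤ C * (1 + t * ‖x‖) ^ e := by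
    intro t ht
    rw [hqe]
    simpa [norm_smul, abs_of_nonneg ht] using h (t • x)
  -- `1 + t‖x‖` lies between `min 1 ‖x‖ * (1 + t)` and `(1 + ‖x‖) * (1 + t)`.
  obtain ⟨K, hK⟩ : ∃ K, ∀ t : ℝ, 0 ≤ t → |q.eval t| ≤ K * (1 + t) ^ e := by
    rcases le_total 0 e with he | he
    · refine ⟨C * (1 + ‖x‖) ^ e, fun t ht => (hqx t ht).trans ?_⟩
      rw [mul_assoc, ← Real.mul_rpow (by positivity) (by positivity)]
      gcongr
      nlinarith
    · refine ⟨C * (min 1 ‖x‖) ^ e, fun t ht => (hqx t ht).trans ?_⟩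
      have hm : 0 < min 1 ‖x‖ := lt_min one_pos hx0
      rw [mul_assoc, ← Real.mul_rpow hm.le (by positivity)]
      refine mul_le_mul_of_nonneg_left
        (Real.rpow_le_rpow_of_nonpos (by positivity) ?_ he) hC0
      nlinarith [min_le_left 1 ‖x‖, min_le_right 1 ‖x‖]
  exact natDegree_le_of_abs_eval_le hq0 hK

theorem exists_real_polynomial_re (p : ℂ[X]) :
    ∃ q : ℝ[X], q.natDegree ≤ p.natDegree ∧ ∀ t : ℝ, q.eval t = (p.eval (t : ℂ)).re := by
  refine ⟨∑ i ∈ Finset.range (p.natDegree + 1), C (p.coeff i).re * X ^ i, ?_, fun t => ?_⟩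
  · refine natDegree_sum_le_of_forall_le _ _ fun i hi => ?_
    exact (natDegree_C_mul_X_pow_le _ _).trans (Nat.lt_succ_iff.1 (Finset.mem_range.1 hi))
  · rw [p.eval_eq_sum_range, Complex.re_sum, Polynomial.eval_finsetSum]
    refine Finset.sum_congr rfl fun i _ => ?_
    rw [← Complex.ofReal_pow, Complex.re_mul_ofReal]
    simp

/-- A function of two real variables that is a polynomial of degree at most `N` in each variable
separately is a polynomial. It is reconstructed by Lagrange interpolation in the first variable,
the values at the nodes `0, …, N` being polynomials in the second one. -/
theorem exists_mvPolynomial_of_separately {F : ℝ → ℝ → ℝ} {N : ℕ}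
    (h0 : ∀ t, ∃ p : ℝ[X], p.natDegree ≤ N ∧ ∀ s, F s t = p.eval s)
    (h1 : ∀ s, ∃ p : ℝ[X], ∀ t, F s t = p.eval t) :
    ∃ P : MvPolynomial (Fin 2) ℝ, ∀ x : Fin 2 → ℝ, F (x 0) (x 1) = MvPolynomial.eval x P := by
  choose p hp hpF using h0
  choose q hqF using h1
  let S : Finset ℕ := Finset.range (N + 1)
  let v : ℕ → ℝ := fun i => i
  refine ⟨∑ i ∈ S, Polynomial.aeval (MvPolynomial.X 1) (q (v i)) *
    Polynomial.aeval (MvPolynomial.X 0) (Lagrange.basis S v i), fun x => ?_⟩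
  have hint := Lagrange.eq_interpolate (s := S) (v := v) (f := p (x 1))
    (fun a _ b _ hab => Nat.cast_injective hab)
    (lt_of_le_of_lt degree_le_natDegree (by
      rw [Finset.card_range]; exact_mod_cast Nat.lt_succ_iff.2 (hp (x 1))))
  have haux : ∀ (r : ℝ[X]) (j : Fin 2),
      MvPolynomial.eval x (Polynomial.aeval (MvPolynomial.X j) r) = r.eval (x j) := by
    intro r j
    rw [← MvPolynomial.coe_aeval_eq_eval, RingHom.coe_coe, ← Polynomial.aeval_algHom_apply]
    simp [Polynomial.aeval_def, Polynomial.eval₂_eq_eval_map]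
  rw [hpF, hint, Lagrange.interpolate_apply, Polynomial.eval_finsetSum, map_sum]
  refine Finset.sum_congr rfl fun i _ => ?_
  rw [map_mul, haux, haux, Polynomial.eval_mul, Polynomial.eval_C, ← hpF, hqF]

/-! ### A Phragmén–Lindelöf theorem of order two -/

theorem one_add_norm_le_two_mul_norm_add_I {z : ℂ} (hz : 0 ≤ z.im) :
    1 + ‖z‖ ≤ 2 * ‖z + Complex.I‖ := by
  have h1 : ‖z + Complex.I‖ ^ 2 = ‖z‖ ^ 2 + 2 * z.im + 1 := by
    rw [← Complex.normSq_eq_norm_sq, ← Complex.normSq_eq_norm_sq, Complex.normSq_apply,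
      Complex.normSq_apply]
    simp
    ring
  refine le_of_sq_le_sq ?_ (by positivity)
  nlinarith [sq_nonneg (1 - ‖z‖)]

/-- The Phragmén–Lindelöf step in the sector `0 ≤ arg w ≤ φ` of opening `φ < π / 2`. The multiplier
`exp (i c w ^ 2)` with `c = A cos φ / (2 sin φ)` has modulus `1` on the positive axis, and exactly
compensates the factor `exp (A (re w) ^ 2)` on the ray `arg w = φ`; the growth of order `2` is
admissible since the opening is less than `π / 2`. In the coordinate `ζ = log w` the sector is a
horizontal strip. -/
theorem norm_le_on_sector {h : ℂ → ℂ} {A M φ : ℝ} (hA : 0 ≤ A) (hφ0 : 0 < φ) (hφ : φ < Real.pi / 2)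
    (hd : ∀ z : ℂ, 0 ≤ z.im → DifferentiableAt ℂ h z)
    (hgrowth : ∀ z : ℂ, 0 ≤ z.im → ‖h z‖ ≤ M * Real.exp (A * z.re ^ 2))
    (hreal : ∀ x : ℝ, ‖h x‖ ≤ M) {ζ : ℂ} (h0 : 0 ≤ ζ.im) (h1 : ζ.im ≤ φ) :
    ‖h (Complex.exp ζ)‖ ≤ M * Real.exp (2 * (A * Real.cos φ / (2 * Real.sin φ)) *
      ((Complex.exp ζ).re * (Complex.exp ζ).im)) := by
  have hM : 0 ≤ M := (norm_nonneg _).trans (hreal 0)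
  have hsin : 0 < Real.sin φ := Real.sin_pos_of_pos_of_lt_pi hφ0 (by linarith [Real.pi_pos])
  have hcos : 0 < Real.cos φ := Real.cos_pos_of_mem_Ioo ⟨by linarith, hφ⟩
  set c : ℝ := A * Real.cos φ / (2 * Real.sin φ) with hc
  have hc0 : 0 ≤ c := by positivity
  let f : ℂ → ℂ := fun ζ => h (Complex.exp ζ) * Complex.exp (Complex.I * c * Complex.exp ζ ^ 2)
  have him : ∀ ζ : ℂ, 0 ≤ ζ.im → ζ.im ≤ φ →
      0 ≤ (Complex.exp ζ).re ∧ 0 ≤ (Complex.exp ζ).im := by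
    intro ζ h0 h1
    rw [Complex.exp_re, Complex.exp_im]
    have := Real.cos_nonneg_of_mem_Icc (x := ζ.im) ⟨by linarith, by linarith⟩
    have := Real.sin_nonneg_of_nonneg_of_le_pi h0 (by linarith)
    constructor <;> positivity
  have hnorm : ∀ ζ : ℂ, ‖f ζ‖ = ‖h (Complex.exp ζ)‖ *
      Real.exp (-(2 * c * ((Complex.exp ζ).re * (Complex.exp ζ).im))) := by
    intro ζ
    simp only [f, norm_mul, Complex.norm_exp]
    congr 2
    simp [sq, Complex.mul_re, Complex.mul_im]
    ring
  have hcl : closure (Complex.im ⁻¹' Set.Ioo 0 φ) ⊆ Complex.im ⁻¹' Set.Icc 0 φ :=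
    closure_minimal (Set.preimage_mono Set.Ioo_subset_Icc_self)
      (isClosed_Icc.preimage Complex.continuous_im)
  have hfd : DiffContOnCl ℂ f (Complex.im ⁻¹' Set.Ioo 0 φ) := by
    refine DifferentiableOn.diffContOnCl fun ζ hζ => ?_
    obtain ⟨h0, h1⟩ := hcl hζ
    refine DifferentiableAt.differentiableWithinAt ?_
    refine DifferentiableAt.mul ?_ (by fun_prop)
    exact (hd _ (him ζ h0 h1).2).comp ζ Complex.differentiableAt_exp
  have key : ‖f ζ‖ ≤ M := by
    refine PhragmenLindelof.horizontal_strip (a := 0) (b := φ) hfd ?_ ?_ ?_ h0 h1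
    · refine ⟨2, ?_, A, IsBigO.of_bound M ?_⟩
      · rw [sub_zero, lt_div_iff₀ hφ0]
        linarith
      · refine Eventually.filter_mono inf_le_right ?_
        rw [eventually_principal]
        intro ζ hζ
        obtain ⟨h2, h3⟩ := him ζ hζ.1.le hζ.2.le
        rw [hnorm, Real.norm_of_nonneg (Real.exp_nonneg _)]
        refine (mul_le_of_le_one_right (norm_nonneg _) ?_).trans ((hgrowth _ h3).trans ?_)
        · rw [Real.exp_le_one_iff]
          have : 0 ≤ 2 * c * ((Complex.exp ζ).re * (Complex.exp ζ).im) := by positivity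
          linarith
        · gcongr
          calc (Complex.exp ζ).re ^ 2 ≤ ‖Complex.exp ζ‖ ^ 2 := by
                rw [sq_le_sq, abs_norm]; exact Complex.abs_re_le_norm _
            _ = Real.exp (2 * ζ.re) := by
                rw [Complex.norm_exp, ← Real.exp_nat_mul]; norm_num
            _ ≤ _ := by gcongr; exact le_abs_self _
    · intro ζ hζ
      rw [hnorm]
      have hx : Complex.exp ζ = (Real.exp ζ.re : ℝ) := by
        apply Complex.ext <;> simp [Complex.exp_re, Complex.exp_im, hζ]
      rw [hx]
      simpa using hreal (Real.exp ζ.re)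
    · intro ζ hζ
      rw [hnorm]
      obtain ⟨h2, h3⟩ := him ζ (by rw [hζ]; exact hφ0.le) hζ.le
      refine (mul_le_mul_of_nonneg_right (hgrowth _ h3) (Real.exp_nonneg _)).trans ?_
      rw [mul_assoc, ← Real.exp_add, Complex.exp_re, Complex.exp_im, hζ, hc]
      refine (mul_le_of_le_one_right hM ?_)
      rw [Real.exp_le_one_iff]
      apply le_of_eq
      field_simp
      ring
  rw [hnorm, Real.exp_neg, ← div_eq_mul_inv, div_le_iff₀ (Real.exp_pos _)] at key
  exact key

/-- Division by `(z + i) ^ N`, which has no zero in the closed upper half-plane, turns polynomial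
growth on the axis into boundedness. In a sector of opening `φ < π / 2` the previous estimate
applies, and its exponential factor tends to `1` as `φ → π / 2`. -/
theorem norm_le_on_first_quadrant {g : ℂ → ℂ} (hg : Differentiable ℂ g) {A M : ℝ} {N : ℕ}
    (hA : 0 ≤ A) (hgrowth : ∀ z : ℂ, ‖g z‖ ≤ M * (1 + |z.im|) ^ N * Real.exp (A * z.re ^ 2))
    (hreal : ∀ x : ℝ, ‖g x‖ ≤ M * (1 + |x|) ^ N) {z : ℂ} (hre : 0 < z.re) (him : 0 ≤ z.im) :
    ‖g z‖ ≤ M * 2 ^ N * (1 + ‖z‖) ^ N := by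
  have hM : 0 ≤ M := by simpa using (norm_nonneg _).trans (hreal 0)
  have hI : ∀ z : ℂ, 0 ≤ z.im → 0 < ‖z + Complex.I‖ := fun z hz => by
    linarith [one_add_norm_le_two_mul_norm_add_I hz, norm_nonneg z]
  let h : ℂ → ℂ := fun z => g z / (z + Complex.I) ^ N
  have hle : ∀ (z : ℂ) (B : ℝ), 0 ≤ z.im → 0 ≤ B → ‖g z‖ ≤ B * (1 + ‖z‖) ^ N →
      ‖h z‖ ≤ B * 2 ^ N := by
    intro z B hz hB hgz
    have := hI z hz
    rw [norm_div, norm_pow, div_le_iff₀ (by positivity), mul_assoc, ← mul_pow]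
    refine hgz.trans ?_
    gcongr
    exact one_add_norm_le_two_mul_norm_add_I hz
  have hd : ∀ z : ℂ, 0 ≤ z.im → DifferentiableAt ℂ h z := fun z hz =>
    (hg z).div (by fun_prop) (pow_ne_zero _ (norm_pos_iff.1 (hI z hz)))
  have hgr : ∀ z : ℂ, 0 ≤ z.im → ‖h z‖ ≤ M * 2 ^ N * Real.exp (A * z.re ^ 2) := by
    intro z hz
    rw [mul_right_comm]
    refine hle z _ hz (by positivity) ((hgrowth z).trans ?_)
    rw [mul_right_comm]
    gcongr
    exact Complex.abs_im_le_norm z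
  have hre' : ∀ x : ℝ, ‖h x‖ ≤ M * 2 ^ N := fun x =>
    hle x M (by simp) hM (by simpa using hreal x)
  have hz0 : z ≠ 0 := fun h0 => by simp [h0] at hre
  have harg : 0 ≤ z.arg := Complex.arg_nonneg_iff.2 him
  have harg' : z.arg < Real.pi / 2 :=
    (abs_lt.1 (Complex.abs_arg_lt_pi_div_two_iff.2 (Or.inl hre))).2
  have hlim : Tendsto (fun φ : ℝ => M * 2 ^ N * Real.exp (2 * (A * Real.cos φ / (2 * Real.sin φ)) *
      (z.re * z.im))) (𝓝[<] (Real.pi / 2)) (𝓝 (M * 2 ^ N)) := by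
    have hcont : ContinuousAt (fun φ : ℝ => M * 2 ^ N * Real.exp (2 * (A * Real.cos φ /
        (2 * Real.sin φ)) * (z.re * z.im))) (Real.pi / 2) := by
      have : (2 * Real.sin (Real.pi / 2)) ≠ 0 := by simp
      fun_prop (disch := assumption)
    simpa using hcont.tendsto.mono_left nhdsWithin_le_nhds
  have hfin : ‖h z‖ ≤ M * 2 ^ N := by
    refine ge_of_tendsto hlim ?_
    filter_upwards [Ioo_mem_nhdsLT harg'] with φ hφ
    have := norm_le_on_sector hA (harg.trans_lt hφ.1) hφ.2 hd hgr hre' (ζ := Complex.log z)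
      (by rwa [Complex.log_im]) (by rw [Complex.log_im]; exact hφ.1.le)
    rwa [Complex.exp_log hz0] at this
  have := hI z him
  rw [norm_div, norm_pow, div_le_iff₀ (by positivity)] at hfin
  refine hfin.trans ?_
  gcongr
  calc ‖z + Complex.I‖ ≤ ‖z‖ + ‖Complex.I‖ := norm_add_le _ _
    _ = 1 + ‖z‖ := by rw [Complex.norm_I, add_comm]

theorem norm_le_of_growth {g : ℂ → ℂ} (hg : Differentiable ℂ g) {A M : ℝ} {N : ℕ}
    (hA : 0 ≤ A) (hgrowth : ∀ z : ℂ, ‖g z‖ ≤ M * (1 + |z.im|) ^ N * Real.exp (A * z.re ^ 2))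
    (hreal : ∀ x : ℝ, ‖g x‖ ≤ M * (1 + |x|) ^ N) (z : ℂ) :
    ‖g z‖ ≤ M * 2 ^ N * (1 + ‖z‖) ^ N := by
  have hM : 0 ≤ M := by simpa using (norm_nonneg _).trans (hreal 0)
  -- The right half-plane: reflect in the real axis if needed.
  have hright : ∀ {g : ℂ → ℂ}, Differentiable ℂ g →
      (∀ z : ℂ, ‖g z‖ ≤ M * (1 + |z.im|) ^ N * Real.exp (A * z.re ^ 2)) →
      (∀ x : ℝ, ‖g x‖ ≤ M * (1 + |x|) ^ N) → ∀ z : ℂ, 0 < z.re →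
      ‖g z‖ ≤ M * 2 ^ N * (1 + ‖z‖) ^ N := by
    intro g hg hgrowth hreal z hz
    rcases le_total 0 z.im with him | him
    · exact norm_le_on_first_quadrant hg hA hgrowth hreal hz him
    · let k : ℂ → ℂ := fun z => (starRingEnd ℂ) (g ((starRingEnd ℂ) z))
      have hk : Differentiable ℂ k := fun z => differentiableAt_conj_conj_iff.2 (hg _)
      have := norm_le_on_first_quadrant hk hA (M := M) (N := N)
        (fun z => by simpa [k] using hgrowth ((starRingEnd ℂ) z))
        (fun x => by simpa [k] using hreal x) (z := (starRingEnd ℂ) z) (by simpa) (by simpa)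
      simpa [k] using this
  rcases lt_trichotomy z.re 0 with h | h | h
  · have := hright (g := fun z => g (-z)) (hg.comp differentiable_neg)
      (fun z => by simpa using hgrowth (-z)) (fun x => by simpa using hreal (-x)) (-z) (by simpa)
    simpa using this
  -- On the imaginary axis the growth hypothesis has no exponential factor.
  · refine (hgrowth z).trans ?_
    rw [h]
    simp only [ne_eq, OfNat.ofNat_ne_zero, not_false_eq_true, zero_pow, mul_zero, Real.exp_zero,
      mul_one]
    have h2 : M ≤ M * 2 ^ N := le_mul_of_one_le_right hM (one_le_pow₀ one_le_two)
    have := Complex.abs_im_le_norm z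
    gcongr
  · exact hright hg hgrowth hreal z h

/-- Liouville's theorem for polynomial growth, from Cauchy's estimates on large circles. -/
theorem exists_polynomial_of_norm_le {g : ℂ → ℂ} (hg : Differentiable ℂ g) {M : ℝ} {N : ℕ}
    (hle : ∀ z : ℂ, ‖g z‖ ≤ M * (1 + ‖z‖) ^ N) :
    ∃ p : ℂ[X], p.natDegree ≤ N ∧ ∀ z, g z = p.eval z := by
  have hM : 0 ≤ M := by simpa using (norm_nonneg _).trans (hle 0)
  have hz : ∀ n, N < n → iteratedDeriv n g 0 = 0 := by
    intro n hn
    have hb : ∀ R : ℝ, 1 ≤ R → ‖iteratedDeriv n g 0‖ ≤ n.factorial * (M * 2 ^ N) * R⁻¹ := by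
      intro R hR
      have hR0 : 0 < R := by linarith
      refine (Complex.norm_iteratedDeriv_le_of_forall_mem_sphere_norm_le n hR0 hg.diffContOnCl
        (C := M * (2 * R) ^ N) fun z hz => ?_).trans ?_
      · refine (hle z).trans ?_
        rw [mem_sphere_zero_iff_norm.1 hz]
        gcongr
        linarith
      · rw [mul_pow, div_le_iff₀ (by positivity)]
        have : R ^ N ≤ R⁻¹ * R ^ n := by
          rw [← div_eq_inv_mul, le_div_iff₀ hR0, ← pow_succ]
          exact pow_le_pow_right₀ hR hn
        calc n.factorial * (M * (2 ^ N * R ^ N)) = n.factorial * (M * 2 ^ N) * R ^ N := by ring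
          _ ≤ n.factorial * (M * 2 ^ N) * (R⁻¹ * R ^ n) := by gcongr
          _ = _ := by ring
    have hlim : Tendsto (fun R : ℝ => n.factorial * (M * 2 ^ N) * R⁻¹) atTop (𝓝 0) := by
      simpa using tendsto_inv_atTop_zero.const_mul ((n.factorial : ℝ) * (M * 2 ^ N))
    refine norm_le_zero_iff.1 (ge_of_tendsto hlim ?_)
    filter_upwards [eventually_ge_atTop 1] with R hR using hb R hR
  refine ⟨∑ n ∈ Finset.range (N + 1), C ((n.factorial : ℂ)⁻¹ * iteratedDeriv n g 0) * X ^ n, ?_,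
    fun z => ?_⟩
  · refine natDegree_sum_le_of_forall_le _ _ fun i hi => ?_
    exact (natDegree_C_mul_X_pow_le _ _).trans (Nat.lt_succ_iff.1 (Finset.mem_range.1 hi))
  · rw [← Complex.taylorSeries_eq_of_entire' 0 z hg, tsum_eq_sum (s := Finset.range (N + 1))]
    · simp [Polynomial.eval_finsetSum]
    · intro n hn
      rw [hz n (by simpa using hn)]
      simp

/-- An entire function of order two whose growth is governed by `exp (A (re z) ^ 2)`, and which
has polynomial growth on the real axis, is a polynomial. -/
theorem exists_polynomial_of_growth {g : ℂ → ℂ} (hg : Differentiable ℂ g) {A M d : ℝ}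
    (hA : 0 ≤ A) (hgrowth : ∀ z : ℂ, ‖g z‖ ≤ M * (1 + |z.im|) ^ d * Real.exp (A * z.re ^ 2))
    (hreal : ∀ x : ℝ, ‖g x‖ ≤ M * (1 + |x|) ^ d) :
    ∃ p : ℂ[X], p.natDegree ≤ ⌈d⌉₊ ∧ ∀ z, g z = p.eval z := by
  have hM : 0 ≤ M := by simpa using (norm_nonneg _).trans (hreal 0)
  have hpow : ∀ t : ℝ, (1 + |t|) ^ d ≤ (1 + |t|) ^ ⌈d⌉₊ := fun t => by
    rw [← Real.rpow_natCast]
    exact Real.rpow_le_rpow_of_exponent_le (by linarith [abs_nonneg t]) (Nat.le_ceil d)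
  refine exists_polynomial_of_norm_le hg (norm_le_of_growth hg hA (M := M)
    (fun z => (hgrowth z).trans ?_) (fun x => (hreal x).trans ?_))
  · gcongr
    exact hpow _
  · gcongr
    exact hpow _

/-! ### Fourier transforms along complex lines -/

theorem norm_exp_line {V : Type*} [NormedAddCommGroup V] [InnerProductSpace ℝ V]
    (ξ e x : V) (z : ℂ) :
    ‖Complex.exp (-(2 * Real.pi * Complex.I) * (⟪x, ξ⟫ + z * ⟪x, e⟫))‖ =
      Real.exp (2 * Real.pi * z.im * ⟪x, e⟫) := by
  rw [Complex.norm_exp]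
  congr 1
  simp
  ring

section Fourier

variable {V : Type*} [NormedAddCommGroup V] [InnerProductSpace ℝ V] [FiniteDimensional ℝ V]
  [MeasurableSpace V] [BorelSpace V]

/-- Polynomial and exponential factors are absorbed by half of a Gaussian. -/
theorem exists_weight_le (d c : ℝ) {a : ℝ} (ha : 0 < a) :
    ∃ K : ℝ, 0 < K ∧ ∀ r : ℝ, 0 ≤ r →
      (1 + r) ^ d * Real.exp (c * r) * Real.exp (-(a * r ^ 2)) ≤ K * Real.exp (-(a / 2 * r ^ 2)) := by
  set N := ⌈d⌉₊
  refine ⟨N.factorial * Real.exp (1 + (1 + c) ^ 2 / (2 * a)), by positivity, fun r hr => ?_⟩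
  have h1 : (1 + r) ^ d ≤ N.factorial * Real.exp (1 + r) := by
    have h2 : (1 + r) ^ d ≤ (1 + r) ^ N := by
      rw [← Real.rpow_natCast]
      exact Real.rpow_le_rpow_of_exponent_le (by linarith) (Nat.le_ceil d)
    have h3 := Real.pow_div_factorial_le_exp (1 + r) (by positivity) N
    rw [div_le_iff₀ (by positivity)] at h3
    linarith
  calc (1 + r) ^ d * Real.exp (c * r) * Real.exp (-(a * r ^ 2))
      ≤ N.factorial * Real.exp (1 + r) * Real.exp (c * r) * Real.exp (-(a * r ^ 2)) := by gcongr
    _ = N.factorial * Real.exp (1 + r + c * r + -(a * r ^ 2)) := by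
        rw [Real.exp_add (1 + r + c * r), Real.exp_add (1 + r)]; ring
    _ ≤ N.factorial * Real.exp (1 + (1 + c) ^ 2 / (2 * a) + -(a / 2 * r ^ 2)) := by
        refine mul_le_mul_of_nonneg_left (Real.exp_le_exp.2 ?_) (by positivity)
        have : (1 + c) ^ 2 / (2 * a) + a / 2 * r ^ 2 - (1 + c) * r =
            ((1 + c) - a * r) ^ 2 / (2 * a) := by field_simp; ring
        have : 0 ≤ ((1 + c) - a * r) ^ 2 / (2 * a) := by positivity
        nlinarith
    _ = _ := by rw [Real.exp_add]; ring

theorem integrable_exp_neg_mul_sq_norm {a : ℝ} (ha : 0 < a) :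
    Integrable fun x : V => Real.exp (-(a * ‖x‖ ^ 2)) := by
  have := (GaussianFourier.integrable_cexp_neg_mul_sq_norm_add (V := V) (b := a) (by simpa) 0 0).norm
  refine this.congr (Eventually.of_forall fun x => ?_)
  simp [Complex.norm_exp, ← Complex.ofReal_pow]

theorem integrable_weight (d c : ℝ) {a : ℝ} (ha : 0 < a) :
    Integrable fun x : V =>
      (1 + ‖x‖) ^ d * Real.exp (c * ‖x‖) * Real.exp (-(a * ‖x‖ ^ 2)) := by
  obtain ⟨K, -, hK⟩ := exists_weight_le d c ha
  refine ((integrable_exp_neg_mul_sq_norm (V := V) (half_pos ha)).const_mul K).mono' ?_ ?_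
  · have : Continuous fun x : V => (1 + ‖x‖) ^ d :=
      (by fun_prop : Continuous fun x : V => 1 + ‖x‖).rpow_const fun x => Or.inl (by positivity)
    exact (by fun_prop : Continuous _).aestronglyMeasurable
  · refine Eventually.of_forall fun x => ?_
    rw [Real.norm_of_nonneg (by positivity)]
    exact hK _ (norm_nonneg _)

theorem integrable_of_norm_le_weight {F : Type*} [NormedAddCommGroup F] {w : V → F}
    (hw : AEStronglyMeasurable w) {d a C : ℝ} (ha : 0 < a)
    (hle : ∀ᵐ x, ‖w x‖ ≤ C * (1 + ‖x‖) ^ d * Real.exp (-(a * ‖x‖ ^ 2))) : Integrable w := by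
  refine ((integrable_weight (V := V) d 0 ha).const_mul C).mono' hw ?_
  filter_upwards [hle] with x hx
  simpa [mul_assoc] using hx

/-- The Fourier transform of `w` along the complexified line `z ↦ ξ + z e`. -/
noncomputable def fourierLine (w : V → ℂ) (ξ e : V) (z : ℂ) : ℂ :=
  ∫ x, w x * Complex.exp (-(2 * Real.pi * Complex.I) * (⟪x, ξ⟫ + z * ⟪x, e⟫))

theorem fourierLine_ofReal (w : V → ℂ) (ξ e : V) (t : ℝ) :
    fourierLine w ξ e t = 𝓕 w (ξ + t • e) := by
  rw [Real.fourier_eq', fourierLine]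
  congr 1 with x
  rw [smul_eq_mul, mul_comm, inner_add_right, inner_smul_right]
  congr 2
  push_cast
  ring

theorem differentiable_fourierLine {w : V → ℂ} (hw : AEStronglyMeasurable w) {d a C : ℝ}
    (ha : 0 < a) (hle : ∀ᵐ x, ‖w x‖ ≤ C * (1 + ‖x‖) ^ d * Real.exp (-(a * ‖x‖ ^ 2)))
    (ξ : V) {e : V} (he : ‖e‖ = 1) : Differentiable ℂ (fourierLine w ξ e) := by
  intro z₀
  have hin : ∀ x : V, |⟪x, e⟫| ≤ ‖x‖ := fun x => by
    simpa [he] using abs_real_inner_le_norm x e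
  have hexp : ∀ (x : V) (z : ℂ), z ∈ Metric.ball z₀ 1 →
      ‖Complex.exp (-(2 * Real.pi * Complex.I) * (⟪x, ξ⟫ + z * ⟪x, e⟫))‖ ≤
        Real.exp (2 * Real.pi * (‖z₀‖ + 1) * ‖x‖) := by
    intro x z hz
    rw [norm_exp_line, Real.exp_le_exp]
    have h1 : |z.im| ≤ ‖z₀‖ + 1 := by
      refine (Complex.abs_im_le_norm z).trans ?_
      have := norm_sub_norm_le z z₀
      have := (mem_ball_iff_norm.1 hz).le
      linarith
    calc 2 * Real.pi * z.im * ⟪x, e⟫ = 2 * Real.pi * (z.im * ⟪x, e⟫) := by ring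
      _ ≤ 2 * Real.pi * (|z.im| * |⟪x, e⟫|) := by
          refine mul_le_mul_of_nonneg_left ?_ (by positivity)
          rw [← abs_mul]
          exact le_abs_self _
      _ ≤ 2 * Real.pi * ((‖z₀‖ + 1) * ‖x‖) := by
          gcongr
          exact hin x
      _ = _ := by ring
  have hmeas : ∀ z : ℂ, AEStronglyMeasurable
      fun x => w x * Complex.exp (-(2 * Real.pi * Complex.I) * (⟪x, ξ⟫ + z * ⟪x, e⟫)) := fun z =>
    hw.mul (by fun_prop : Continuous _).aestronglyMeasurable
  have hC : ∀ᵐ x, ‖w x‖ * Real.exp (2 * Real.pi * (‖z₀‖ + 1) * ‖x‖) ≤ C * ((1 + ‖x‖) ^ d *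
      Real.exp (2 * Real.pi * (‖z₀‖ + 1) * ‖x‖) * Real.exp (-(a * ‖x‖ ^ 2))) := by
    filter_upwards [hle] with x hx
    calc _ ≤ C * (1 + ‖x‖) ^ d * Real.exp (-(a * ‖x‖ ^ 2)) *
          Real.exp (2 * Real.pi * (‖z₀‖ + 1) * ‖x‖) := by gcongr
      _ = _ := by ring
  refine (hasDerivAt_integral_of_dominated_loc_of_deriv_le (μ := volume)
    (F := fun z x => w x * Complex.exp (-(2 * Real.pi * Complex.I) * (⟪x, ξ⟫ + z * ⟪x, e⟫)))
    (F' := fun z x => w x * (Complex.exp (-(2 * Real.pi * Complex.I) * (⟪x, ξ⟫ + z * ⟪x, e⟫)) *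
      (-(2 * Real.pi * Complex.I) * ⟪x, e⟫)))
    (bound := fun x => 2 * Real.pi * C * ((1 + ‖x‖) ^ (d + 1) *
      Real.exp (2 * Real.pi * (‖z₀‖ + 1) * ‖x‖) * Real.exp (-(a * ‖x‖ ^ 2))))
    (Metric.ball_mem_nhds z₀ one_pos) (Eventually.of_forall hmeas) ?_ ?_ ?_ ?_ ?_).2.differentiableAt
  · refine ((integrable_weight (V := V) d (2 * Real.pi * (‖z₀‖ + 1)) ha).const_mul C).mono'
      (hmeas z₀) ?_
    filter_upwards [hC] with x hx
    refine le_trans ?_ hx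
    rw [norm_mul]
    gcongr
    exact hexp x z₀ (Metric.mem_ball_self one_pos)
  · exact hw.mul (by fun_prop : Continuous _).aestronglyMeasurable
  · filter_upwards [hC] with x hx z hz
    have h1 : ‖(-(2 * Real.pi * Complex.I) * ⟪x, e⟫ : ℂ)‖ ≤ 2 * Real.pi * (1 + ‖x‖) := by
      simp only [norm_mul, norm_neg, Complex.norm_real, Complex.norm_I, Complex.norm_ofNat,
        Real.norm_eq_abs, abs_of_pos Real.pi_pos, mul_one]
      gcongr
      linarith [hin x]
    rw [norm_mul, norm_mul, ← mul_assoc]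
    calc _ ≤ ‖w x‖ * Real.exp (2 * Real.pi * (‖z₀‖ + 1) * ‖x‖) * (2 * Real.pi * (1 + ‖x‖)) := by
          gcongr
          exact hexp x z hz
      _ ≤ C * ((1 + ‖x‖) ^ d * Real.exp (2 * Real.pi * (‖z₀‖ + 1) * ‖x‖) *
          Real.exp (-(a * ‖x‖ ^ 2))) * (2 * Real.pi * (1 + ‖x‖)) := by gcongr
      _ = _ := by rw [Real.rpow_add (by positivity), Real.rpow_one]; ring
  · exact (integrable_weight (V := V) (d + 1) (2 * Real.pi * (‖z₀‖ + 1)) ha).const_mul _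
  · refine Eventually.of_forall fun x z _ => ?_
    have h1 : HasDerivAt (fun z : ℂ => -(2 * Real.pi * Complex.I) * (⟪x, ξ⟫ + z * ⟪x, e⟫))
        (-(2 * Real.pi * Complex.I) * ⟪x, e⟫) z := by
      simpa using ((hasDerivAt_id z).mul_const (⟪x, e⟫ : ℂ) |>.const_add (⟪x, ξ⟫ : ℂ)).const_mul
        (-(2 * Real.pi * Complex.I))
    exact h1.cexp.const_mul (w x)

/-- The growth of the Fourier transform of `w` off the real axis, obtained by completing the square
and translating by `(im z / α) e`. -/
theorem norm_fourierLine_le {w : V → ℂ} {d α C : ℝ} (hd : 0 ≤ d) (hα : 0 < α) (hC : 0 ≤ C)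
    (hle : ∀ᵐ x, ‖w x‖ ≤ C * (1 + ‖x‖) ^ d * Real.exp (-(Real.pi * α * ‖x‖ ^ 2)))
    {e : V} (he : ‖e‖ = 1) : ∃ M : ℝ, ∀ (ξ : V) (z : ℂ),
      ‖fourierLine w ξ e z‖ ≤ M * (1 + |z.im|) ^ d * Real.exp (Real.pi * z.im ^ 2 / α) := by
  set J := ∫ x : V, (1 + ‖x‖) ^ d * Real.exp (-(Real.pi * α * ‖x‖ ^ 2)) with hJ
  have hJint : Integrable fun x : V => (1 + ‖x‖) ^ d * Real.exp (-(Real.pi * α * ‖x‖ ^ 2)) := by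
    simpa using integrable_weight (V := V) d 0 (mul_pos Real.pi_pos hα)
  have hJ0 : 0 ≤ J := integral_nonneg fun x => by positivity
  refine ⟨C * J * (1 + α⁻¹) ^ d, fun ξ z => ?_⟩
  set η := z.im
  set v : V := (η / α) • e with hv
  have hvn : ‖v‖ = |η| / α := by rw [hv, norm_smul, he, mul_one, norm_div, Real.norm_eq_abs,
    Real.norm_of_nonneg hα.le]
  have hsq : ∀ x : V, Real.exp (-(Real.pi * α * ‖x‖ ^ 2)) * Real.exp (2 * Real.pi * η * ⟪x, e⟫) =
      Real.exp (-(Real.pi * α * ‖x - v‖ ^ 2)) * Real.exp (Real.pi * η ^ 2 / α) := by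
    intro x
    rw [← Real.exp_add, ← Real.exp_add, @norm_sub_sq_real, hvn, hv, inner_smul_right, div_pow,
      sq_abs]
    congr 1
    field_simp
    ring
  have hint : Integrable fun x : V => C * (1 + ‖v‖) ^ d * Real.exp (Real.pi * η ^ 2 / α) *
      ((1 + ‖x - v‖) ^ d * Real.exp (-(Real.pi * α * ‖x - v‖ ^ 2))) :=
    (hJint.comp_sub_right v).const_mul _
  have hbound : ‖fourierLine w ξ e z‖ ≤ C * (1 + ‖v‖) ^ d * Real.exp (Real.pi * η ^ 2 / α) * J := by
    rw [hJ, ← integral_sub_right_eq_self _ v, ← integral_const_mul]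
    refine norm_integral_le_of_norm_le hint ?_
    filter_upwards [hle] with x hx
    rw [norm_mul, norm_exp_line]
    have htri : 1 + ‖x‖ ≤ (1 + ‖v‖) * (1 + ‖x - v‖) := by
      have := norm_sub_norm_le x v
      nlinarith [norm_nonneg v, norm_nonneg (x - v)]
    calc _ ≤ C * (1 + ‖x‖) ^ d * Real.exp (-(Real.pi * α * ‖x‖ ^ 2)) *
          Real.exp (2 * Real.pi * η * ⟪x, e⟫) := by gcongr
      _ = C * (1 + ‖x‖) ^ d * (Real.exp (-(Real.pi * α * ‖x - v‖ ^ 2)) *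
          Real.exp (Real.pi * η ^ 2 / α)) := by rw [mul_assoc, hsq]
      _ ≤ C * ((1 + ‖v‖) * (1 + ‖x - v‖)) ^ d * (Real.exp (-(Real.pi * α * ‖x - v‖ ^ 2)) *
          Real.exp (Real.pi * η ^ 2 / α)) := by gcongr
      _ = _ := by rw [Real.mul_rpow (by positivity) (by positivity)]; ring
  have hv2 : (1 + ‖v‖) ^ d ≤ (1 + α⁻¹) ^ d * (1 + |η|) ^ d := by
    rw [← Real.mul_rpow (by positivity) (by positivity), hvn, div_eq_mul_inv]
    have := abs_nonneg η
    have := inv_pos.2 hα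
    gcongr
    nlinarith
  calc _ ≤ _ := hbound
    _ ≤ C * ((1 + α⁻¹) ^ d * (1 + |η|) ^ d) * Real.exp (Real.pi * η ^ 2 / α) * J := by gcongr
    _ = _ := by ring

/-- Hardy's theorem along a line, in the critical case `α * β = 1`: up to a Gaussian factor, the
Fourier transform is a polynomial along each line. -/
theorem exists_polynomial_fourier_line {w : V → ℂ} (hw : AEStronglyMeasurable w) {d α β C : ℝ}
    (hd : 0 ≤ d) (hα : 0 < α) (hβ : 0 < β) (hαβ : α * β = 1) (hC : 0 ≤ C)
    (hle : ∀ᵐ x, ‖w x‖ ≤ C * (1 + ‖x‖) ^ d * Real.exp (-(Real.pi * α * ‖x‖ ^ 2)))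
    (hle' : ∀ y, ‖𝓕 w y‖ ≤ C * (1 + ‖y‖) ^ d * Real.exp (-(Real.pi * β * ‖y‖ ^ 2)))
    {ξ e : V} (he : ‖e‖ = 1) (hξ : ⟪ξ, e⟫ = 0) :
    ∃ p : ℂ[X], p.natDegree ≤ ⌈d⌉₊ ∧
      ∀ t : ℝ, 𝓕 w (ξ + t • e) * Real.exp (Real.pi * β * ‖ξ + t • e‖ ^ 2) = p.eval (t : ℂ) := by
  have hα' : α⁻¹ = β := inv_eq_of_mul_eq_one_right hαβ
  have hnorm : ∀ t : ℝ, ‖ξ + t • e‖ ^ 2 = ‖ξ‖ ^ 2 + t ^ 2 := by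
    intro t
    rw [@norm_add_sq_real, inner_smul_right, hξ, norm_smul, he]
    simp
  obtain ⟨M, hM⟩ := norm_fourierLine_le hd hα hC hle he
  let g : ℂ → ℂ := fun z => fourierLine w ξ e z * Complex.exp (Real.pi * β * (‖ξ‖ ^ 2 + z ^ 2))
  have hgt : ∀ t : ℝ, g t = 𝓕 w (ξ + t • e) * Real.exp (Real.pi * β * ‖ξ + t • e‖ ^ 2) := by
    intro t
    simp only [g, fourierLine_ofReal, hnorm]
    push_cast
    rfl
  have hg : Differentiable ℂ g :=
    (differentiable_fourierLine hw (mul_pos Real.pi_pos hα) hle ξ he).mul (by fun_prop)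
  set B := max (M * Real.exp (Real.pi * β * ‖ξ‖ ^ 2)) (C * (1 + ‖ξ‖) ^ d)
  suffices h : (∀ z : ℂ, ‖g z‖ ≤ B * (1 + |z.im|) ^ d * Real.exp (Real.pi * β * z.re ^ 2)) ∧
      ∀ t : ℝ, ‖g t‖ ≤ B * (1 + |t|) ^ d by
    obtain ⟨p, hp, hpe⟩ := exists_polynomial_of_growth hg (by positivity) h.1 h.2
    exact ⟨p, hp, fun t => by rw [← hgt, hpe]⟩
  constructor
  · intro z
    have hexp : ‖Complex.exp (Real.pi * β * (‖ξ‖ ^ 2 + z ^ 2))‖ =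
        Real.exp (Real.pi * β * ‖ξ‖ ^ 2) * Real.exp (Real.pi * β * z.re ^ 2) *
          (Real.exp (Real.pi * z.im ^ 2 / α))⁻¹ := by
      rw [Complex.norm_exp, ← Real.exp_neg, ← Real.exp_add, ← Real.exp_add]
      congr 1
      rw [div_eq_mul_inv, hα']
      simp [sq, ← Complex.ofReal_mul]
      ring
    calc ‖g z‖ ≤ M * (1 + |z.im|) ^ d * Real.exp (Real.pi * z.im ^ 2 / α) *
          (Real.exp (Real.pi * β * ‖ξ‖ ^ 2) * Real.exp (Real.pi * β * z.re ^ 2) *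
          (Real.exp (Real.pi * z.im ^ 2 / α))⁻¹) := by
            rw [norm_mul, hexp]
            gcongr
            exact hM ξ z
      _ = M * Real.exp (Real.pi * β * ‖ξ‖ ^ 2) * (1 + |z.im|) ^ d *
          Real.exp (Real.pi * β * z.re ^ 2) := by
            have := (Real.exp_pos (Real.pi * z.im ^ 2 / α)).ne'
            field_simp
      _ ≤ _ := by
            gcongr
            exact le_max_left _ _
  · intro t
    rw [hgt, norm_mul, Complex.norm_real, Real.norm_of_nonneg (Real.exp_nonneg _)]
    have htri : 1 + ‖ξ + t • e‖ ≤ (1 + ‖ξ‖) * (1 + |t|) := by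
      have := norm_add_le ξ (t • e)
      rw [norm_smul, he, mul_one, Real.norm_eq_abs] at this
      nlinarith [norm_nonneg ξ, abs_nonneg t]
    calc _ ≤ C * (1 + ‖ξ + t • e‖) ^ d * Real.exp (-(Real.pi * β * ‖ξ + t • e‖ ^ 2)) *
          Real.exp (Real.pi * β * ‖ξ + t • e‖ ^ 2) := by
            gcongr
            exact hle' _
      _ = C * (1 + ‖ξ + t • e‖) ^ d := by
            rw [mul_assoc, ← Real.exp_add]
            simp
      _ ≤ C * ((1 + ‖ξ‖) * (1 + |t|)) ^ d := by gcongr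
      _ = C * (1 + ‖ξ‖) ^ d * (1 + |t|) ^ d := by
            rw [Real.mul_rpow (by positivity) (by positivity)]; ring
      _ ≤ _ := by
            gcongr
            exact le_max_right _ _

end Fourier

/-! ### Hardy's theorem for real functions on the plane -/

section Inversion

variable {V : Type*} [NormedAddCommGroup V] [InnerProductSpace ℝ V] [FiniteDimensional ℝ V]
  [MeasurableSpace V] [BorelSpace V]

theorem continuous_fourier_of_integrable {f : V → ℂ} (hf : Integrable f) : Continuous (𝓕 f) :=
  VectorFourier.fourierIntegral_continuous Real.continuous_fourierChar
    (L := innerₗ V) continuous_inner hf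

theorem continuous_fourierInv_of_integrable {f : V → ℂ} (hf : Integrable f) :
    Continuous (𝓕⁻ f) := by
  rw [Real.fourierInv_eq_fourier_comp_neg]
  exact continuous_fourier_of_integrable hf.comp_neg

theorem integral_fourier_mul_eq {f g : V → ℂ} (hf : Integrable f) (hg : Integrable g) :
    ∫ y, 𝓕 f y * g y = ∫ x, f x * 𝓕 g x := by
  simpa using! VectorFourier.integral_fourierIntegral_smul_eq_flip (L := innerₗ V)
      Real.continuous_fourierChar continuous_inner hf hg

theorem integral_fourierInv_mul_eq {f g : V → ℂ} (hf : Integrable f) (hg : Integrable g) :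
    ∫ y, 𝓕⁻ f y * g y = ∫ x, f x * 𝓕⁻ g x := by
  rw [Real.fourierInv_eq_fourier_comp_neg f, integral_fourier_mul_eq hf.comp_neg hg,
    ← integral_neg_eq_self]
  simp [Real.fourierInv_eq_fourier_neg]

/-- Fourier inversion almost everywhere, without any continuity assumption on `f`, by testing
against smooth compactly supported functions. -/
theorem ae_eq_fourier_fourierInv {f : V → ℂ} (hf : Integrable f) (hf' : Integrable (𝓕⁻ f)) :
    f =ᵐ[volume] 𝓕 (𝓕⁻ f) := by
  refine ae_eq_of_integral_contDiff_smul_eq hf.locallyIntegrable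
    (continuous_fourier_of_integrable hf').locallyIntegrable fun g hg hgs => ?_
  have hgs' : HasCompactSupport fun x => (g x : ℂ) := hgs.comp_left Complex.ofReal_zero
  let φ : SchwartzMap V ℂ := hgs'.toSchwartzMap (Complex.ofRealCLM.contDiff.comp hg)
  have hφ : ∀ x, (g x : ℂ) = φ x := fun x => rfl
  have hFφ : Integrable (𝓕 (φ : V → ℂ)) := by
    rw [← SchwartzMap.fourier_coe]
    exact (𝓕 φ).integrable
  simp_rw [Complex.real_smul, hφ]
  rw [← integral_fourier_mul_eq φ.integrable hf', ← integral_fourierInv_mul_eq hFφ hf,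
    φ.continuous.fourierInv_fourier_eq φ.integrable hFφ]

theorem le_of_ae_le {f g : V → ℝ} (hf : Continuous f) (hg : Continuous g) (h : ∀ᵐ x, f x ≤ g x)
    (x : V) : f x ≤ g x := by
  have hd : Dense {x | f x ≤ g x} := Measure.dense_of_ae h
  have := (isClosed_le hf hg).closure_eq ▸ hd.closure_eq
  exact (this ▸ Set.mem_univ x : x ∈ {x | f x ≤ g x})

end Inversion

theorem continuous_weight {V : Type*} [NormedAddCommGroup V] (C d a : ℝ) :
    Continuous fun x : V => C * (1 + ‖x‖) ^ d * Real.exp (-(a * ‖x‖ ^ 2)) := by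
  have : Continuous fun x : V => (1 + ‖x‖) ^ d :=
    (by fun_prop : Continuous fun x : V => 1 + ‖x‖).rpow_const fun x => Or.inl (by positivity)
  fun_prop

theorem continuous_eval (P : MvPolynomial (Fin 2) ℝ) :
    Continuous fun x : Plane => MvPolynomial.eval (fun i => x i) P :=
  P.continuous_eval.comp (by fun_prop)

/-- The shape of a function in the critical case, without the degree bound. Hardy's theorem along
lines is applied to the inverse transform of `u`, whose transform is `u`; thus `u` divided by the
Gaussian is a polynomial on each line parallel to an axis. -/
theorem exists_ae_eq_gaussian_mul_polynomial {u : Plane → ℝ} (hu : AEStronglyMeasurable u)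
    {d α β C : ℝ} (hd : 0 ≤ d) (hα : 0 < α) (hβ : 0 < β) (hαβ : α * β = 1) (hC : 0 ≤ C)
    (hle : ∀ᵐ x, |u x| ≤ C * (1 + ‖x‖) ^ d * Real.exp (-(Real.pi * α * ‖x‖ ^ 2)))
    (hle' : ∀ᵐ y, ‖𝓕 (fun x => (u x : ℂ)) y‖ ≤
      C * (1 + ‖y‖) ^ d * Real.exp (-(Real.pi * β * ‖y‖ ^ 2))) :
    ∃ P : MvPolynomial (Fin 2) ℝ, ∀ᵐ x : Plane,
      u x = Real.exp (-(Real.pi * α * ‖x‖ ^ 2)) * MvPolynomial.eval (fun i => x i) P := by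
  set U : Plane → ℂ := fun x => u x with hU
  have hUm : AEStronglyMeasurable U := Complex.continuous_ofReal.comp_aestronglyMeasurable hu
  have hUint : Integrable U := integrable_of_norm_le_weight hUm (mul_pos Real.pi_pos hα)
    (C := C) (d := d) (by simpa [hU] using hle)
  set W : Plane → ℂ := 𝓕⁻ U with hW
  have hWc : Continuous W := continuous_fourierInv_of_integrable hUint
  have hWle : ∀ y, ‖W y‖ ≤ C * (1 + ‖y‖) ^ d * Real.exp (-(Real.pi * β * ‖y‖ ^ 2)) := by
    intro y
    rw [hW, Real.fourierInv_eq_fourier_neg]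
    simpa using le_of_ae_le (continuous_fourier_of_integrable hUint).norm
      (continuous_weight C d (Real.pi * β)) hle' (-y)
  have hWint : Integrable W := integrable_of_norm_le_weight hWc.aestronglyMeasurable
    (mul_pos Real.pi_pos hβ) (Eventually.of_forall hWle)
  have hinv : U =ᵐ[volume] 𝓕 W := ae_eq_fourier_fourierInv hUint hWint
  have hHle : ∀ x, ‖𝓕 W x‖ ≤ C * (1 + ‖x‖) ^ d * Real.exp (-(Real.pi * α * ‖x‖ ^ 2)) := by
    refine le_of_ae_le (continuous_fourier_of_integrable hWint).norm (continuous_weight C d _) ?_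
    filter_upwards [hinv, hle] with x hx hx'
    rw [← hx]
    simpa [hU] using hx'
  have hline : ∀ ξ e : Plane, ‖e‖ = 1 → ⟪ξ, e⟫ = 0 → ∃ q : ℝ[X], q.natDegree ≤ ⌈d⌉₊ ∧
      ∀ t : ℝ, (𝓕 W (ξ + t • e)).re * Real.exp (Real.pi * α * ‖ξ + t • e‖ ^ 2) = q.eval t := by
    intro ξ e he hξ
    obtain ⟨p, hp, hpe⟩ := exists_polynomial_fourier_line hWc.aestronglyMeasurable hd hβ hα
      (by rw [mul_comm, hαβ]) hC (Eventually.of_forall hWle) hHle he hξ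
    obtain ⟨q, hq, hqe⟩ := exists_real_polynomial_re p
    exact ⟨q, hq.trans hp, fun t => by rw [hqe, ← hpe, Complex.re_mul_ofReal]⟩
  let F : ℝ → ℝ → ℝ := fun s t =>
    (𝓕 W !₂[s, t]).re * Real.exp (Real.pi * α * ‖(!₂[s, t] : Plane)‖ ^ 2)
  have h01 : ∀ s t : ℝ, (!₂[s, t] : Plane) = !₂[0, t] + s • EuclideanSpace.single 0 1 := by
    intro s t
    ext i
    fin_cases i <;> simp
  have h10 : ∀ s t : ℝ, (!₂[s, t] : Plane) = !₂[s, 0] + t • EuclideanSpace.single 1 1 := by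
    intro s t
    ext i
    fin_cases i <;> simp
  obtain ⟨P, hP⟩ := exists_mvPolynomial_of_separately (F := F) (N := ⌈d⌉₊)
    (fun t => by
      obtain ⟨q, hq, hqe⟩ := hline !₂[0, t] (EuclideanSpace.single 0 1) (by simp)
        (by simp [PiLp.inner_apply])
      exact ⟨q, hq, fun s => by rw [← hqe, ← h01]⟩)
    (fun s => by
      obtain ⟨q, hq, hqe⟩ := hline !₂[s, 0] (EuclideanSpace.single 1 1) (by simp)
        (by simp [PiLp.inner_apply])
      exact ⟨q, fun t => by rw [← hqe, ← h10]⟩)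
  refine ⟨P, ?_⟩
  filter_upwards [hinv] with x hx
  have hxx : (!₂[x 0, x 1] : Plane) = x := by
    ext i
    fin_cases i <;> simp
  have h2 := hP fun i => x i
  simp only [F, hxx] at h2
  rw [← h2, ← hx, mul_left_comm, ← Real.exp_add]
  simp [hU]

theorem exists_ae_eq_gaussian_mul_polynomial_degree_le {u : Plane → ℝ}
    (hu : AEStronglyMeasurable u)
    {d α β C : ℝ} (hd : 0 ≤ d) (hα : 0 < α) (hβ : 0 < β) (hαβ : α * β = 1) (hC : 0 ≤ C)
    (hle : ∀ᵐ x, |u x| ≤ C * (1 + ‖x‖) ^ d * Real.exp (-(Real.pi * α * ‖x‖ ^ 2)))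
    (hle' : ∀ᵐ y, ‖𝓕 (fun x => (u x : ℂ)) y‖ ≤
      C * (1 + ‖y‖) ^ d * Real.exp (-(Real.pi * β * ‖y‖ ^ 2))) :
    ∃ P : MvPolynomial (Fin 2) ℝ, (P.totalDegree : ℝ) ≤ d ∧ ∀ᵐ x : Plane,
      u x = Real.exp (-(Real.pi * α * ‖x‖ ^ 2)) * MvPolynomial.eval (fun i => x i) P := by
  obtain ⟨P, hP⟩ := exists_ae_eq_gaussian_mul_polynomial hu hd hα hβ hαβ hC hle hle'
  refine ⟨P, ?_, hP⟩
  rcases eq_or_ne P 0 with h0 | h0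
  · simpa [h0] using hd
  refine totalDegree_le_of_abs_eval_le h0 (C := C) (le_of_ae_le (continuous_eval P).abs
    (by simpa using continuous_weight (V := Plane) C d 0) ?_)
  filter_upwards [hP, hle] with x hx hx'
  rw [hx, abs_mul, abs_of_pos (Real.exp_pos _), mul_comm] at hx'
  exact le_of_mul_le_mul_right hx' (Real.exp_pos _)

/-- If `α * β > 1`, the critical case with `α` lowered to `β⁻¹` gives a polynomial, and the excess
decay of `u` makes it vanish at infinity. -/
theorem ae_eq_zero_of_decay {u : Plane → ℝ} (hu : AEStronglyMeasurable u)
    {d α β C : ℝ} (hd : 0 ≤ d) (hβ : 0 < β) (hαβ : 1 < α * β) (hC : 0 ≤ C)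
    (hle : ∀ᵐ x, |u x| ≤ C * (1 + ‖x‖) ^ d * Real.exp (-(Real.pi * α * ‖x‖ ^ 2)))
    (hle' : ∀ᵐ y, ‖𝓕 (fun x => (u x : ℂ)) y‖ ≤
      C * (1 + ‖y‖) ^ d * Real.exp (-(Real.pi * β * ‖y‖ ^ 2))) : u =ᵐ[volume] 0 := by
  have hlt : β⁻¹ < α := by rwa [inv_lt_iff_one_lt_mul₀ hβ]
  have hpos : 0 < Real.pi * (α - β⁻¹) := mul_pos Real.pi_pos (sub_pos.2 hlt)
  obtain ⟨P, hP⟩ := exists_ae_eq_gaussian_mul_polynomial hu hd (inv_pos.2 hβ) hβ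
    (inv_mul_cancel₀ hβ.ne') hC (by
      filter_upwards [hle] with x hx
      refine hx.trans ?_
      gcongr) hle'
  have hP0 : P = 0 := by
    by_contra h0
    obtain ⟨K, hK0, hK⟩ := exists_weight_le (d + 1) 0 hpos
    have hw : ∀ r : ℝ, 0 ≤ r → (1 + r) ^ d * Real.exp (-(Real.pi * (α - β⁻¹) * r ^ 2)) ≤
        K * (1 + r) ^ (-1 : ℝ) := by
      intro r hr
      have h1 := hK r hr
      have h2 : Real.exp (-(Real.pi * (α - β⁻¹) / 2 * r ^ 2)) ≤ 1 := by
        rw [Real.exp_le_one_iff]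
        have : 0 ≤ Real.pi * (α - β⁻¹) / 2 * r ^ 2 := by positivity
        linarith
      rw [Real.rpow_add (by positivity), Real.rpow_one, zero_mul, Real.exp_zero, mul_one] at h1
      rw [Real.rpow_neg_one, ← div_eq_mul_inv, le_div_iff₀ (by positivity)]
      nlinarith
    have := totalDegree_le_of_abs_eval_le h0 (C := C * K) (e := -1) (fun x => ?_)
    · have h3 : (0 : ℝ) ≤ P.totalDegree := Nat.cast_nonneg _
      linarith
    refine (le_of_ae_le (continuous_eval P).abs (continuous_weight C d (Real.pi * (α - β⁻¹))) ?_
      x).trans ?_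
    · filter_upwards [hP, hle] with x hx hx'
      rw [hx, abs_mul, abs_of_pos (Real.exp_pos _), mul_comm] at hx'
      refine le_of_mul_le_mul_right (hx'.trans_eq ?_) (Real.exp_pos _)
      rw [mul_assoc _ (Real.exp _) (Real.exp _), ← Real.exp_add]
      congr 2
      ring
    · rw [mul_assoc C, mul_assoc C]
      exact mul_le_mul_of_nonneg_left (hw _ (norm_nonneg x)) hC
  filter_upwards [hP] with x hx
  simpa [hP0] using hx

/-! ### The quaternion Fourier transform of a real function -/

theorem quaternion_norm_sq (q : ℍ) : ‖q‖ ^ 2 = q.re ^ 2 + q.imI ^ 2 + q.imJ ^ 2 + q.imK ^ 2 := by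
  rw [sq, ← Quaternion.normSq_eq_norm_mul_self, Quaternion.normSq_def']

/-- The reflection `(y₁, y₂) ↦ (y₁, -y₂)`. -/
def reflect (y : Plane) : Plane := !₂[y 0, -y 1]

theorem norm_reflect (y : Plane) : ‖reflect y‖ = ‖y‖ := by
  simp [reflect, EuclideanSpace.norm_eq]

theorem qi_re : qi.re = 0 := rfl
theorem qi_imI : qi.imI = 1 := rfl
theorem qi_imJ : qi.imJ = 0 := rfl
theorem qi_imK : qi.imK = 0 := rfl
theorem qj_re : qj.re = 0 := rfl
theorem qj_imI : qj.imI = 0 := rfl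
theorem qj_imJ : qj.imJ = 1 := rfl
theorem qj_imK : qj.imK = 0 := rfl

/-- The real-linear map `ℂ × ℂ → ℍ` that recovers `e^{-iθ} e^{-jφ}` from the two complex numbers
`e^{-i(θ+φ)}` and `e^{-i(θ-φ)}`. It multiplies the norm of `ℂ²` by `1 / √2`. -/
noncomputable def splitLinear : ℂ × ℂ →ₗ[ℝ] ℍ where
  toFun p := ((p.1.re + p.2.re) / 2) • 1 + ((p.1.im + p.2.im) / 2) • qi +
    ((p.1.im - p.2.im) / 2) • qj + ((p.2.re - p.1.re) / 2) • (qi * qj)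
  map_add' p q := by simp only [Prod.fst_add, Prod.snd_add, Complex.add_re, Complex.add_im]; module
  map_smul' c p := by
    simp only [Prod.smul_fst, Prod.smul_snd, Complex.real_smul, Complex.re_ofReal_mul,
      Complex.im_ofReal_mul, RingHom.id_apply]
    module

theorem splitLinear_apply (p : ℂ × ℂ) : splitLinear p = ((p.1.re + p.2.re) / 2) • 1 +
    ((p.1.im + p.2.im) / 2) • qi + ((p.1.im - p.2.im) / 2) • qj +
    ((p.2.re - p.1.re) / 2) • (qi * qj) := rfl

theorem norm_sq_splitLinear (p : ℂ × ℂ) :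
    ‖splitLinear p‖ ^ 2 = (‖p.1‖ ^ 2 + ‖p.2‖ ^ 2) / 2 := by
  rw [quaternion_norm_sq, ← Complex.normSq_eq_norm_sq, ← Complex.normSq_eq_norm_sq,
    Complex.normSq_apply, Complex.normSq_apply, splitLinear_apply]
  simp [qi_re, qi_imI, qi_imJ, qi_imK, qj_re, qj_imI, qj_imJ, qj_imK]
  ring

theorem eulerExp_mul_mul (a θ φ : ℝ) :
    eulerExp qi (-θ) * (a : ℍ) * eulerExp qj (-φ) =
      splitLinear (Complex.exp (↑(-(θ + φ)) * Complex.I) * a,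
        Complex.exp (↑(-(θ - φ)) * Complex.I) * a) := by
  simp only [splitLinear_apply, Complex.re_mul_ofReal, Complex.im_mul_ofReal,
    Complex.exp_ofReal_mul_I_re, Complex.exp_ofReal_mul_I_im, Real.cos_neg, Real.sin_neg,
    Real.cos_add, Real.sin_add, Real.cos_sub, Real.sin_sub, eulerExp]
  ext <;> simp [qi_re, qi_imI, qi_imJ, qi_imK, qj_re, qj_imI, qj_imJ, qj_imK] <;> ring

/-- The quaternion Fourier transform of a real function is determined by its complex Fourier
transform at `y` and at the reflected point. -/
theorem qft_eq_splitLinear {u : Plane → ℝ} (hu : Integrable u) (y : Plane) :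
    qft (fun x => (u x : ℍ)) y =
      splitLinear (𝓕 (fun x => (u x : ℂ)) y, 𝓕 (fun x => (u x : ℂ)) (reflect y)) := by
  have hint : ∀ y : Plane, Integrable fun x : Plane =>
      Complex.exp (↑(-2 * Real.pi * ⟪x, y⟫) * Complex.I) * u x := by
    intro y
    refine hu.ofReal.bdd_mul (c := 1) (by fun_prop : Continuous _).aestronglyMeasurable
      (Eventually.of_forall fun x => ?_)
    rw [Complex.norm_exp_ofReal_mul_I]
  have hpair := integral_pair (hint y) (hint (reflect y))
  have hcomm := (LinearMap.toContinuousLinearMap splitLinear).integral_comp_comm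
    ((hint y).prodMk (hint (reflect y)))
  rw [hpair] at hcomm
  simp_rw [Real.fourier_eq', smul_eq_mul]
  refine Eq.trans ?_ hcomm
  rw [qft]
  congr 1 with x : 1
  rw [eulerExp_mul_mul, LinearMap.coe_toContinuousLinearMap']
  congr 5 <;> simp [PiLp.inner_apply, reflect, Fin.sum_univ_two] <;> ring

theorem norm_sq_qft {u : Plane → ℝ} (hu : Integrable u) (y : Plane) :
    ‖qft (fun x => (u x : ℍ)) y‖ ^ 2 = (‖𝓕 (fun x => (u x : ℂ)) y‖ ^ 2 +
      ‖𝓕 (fun x => (u x : ℂ)) (reflect y)‖ ^ 2) / 2 := by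
  rw [qft_eq_splitLinear hu, norm_sq_splitLinear]

/-- The sharp constant is `√2`; the value `2` keeps the expressions rational. -/
theorem norm_fourier_le_of_qft_le {u : Plane → ℝ} (hu : Integrable u) {y : Plane} {B : ℝ}
    (hB : ‖qft (fun x => (u x : ℍ)) y‖ ≤ B) : ‖𝓕 (fun x => (u x : ℂ)) y‖ ≤ 2 * B := by
  have h1 := norm_sq_qft hu y
  have h0 := (norm_nonneg _).trans hB
  refine abs_le_of_sq_le_sq' ?_ (by positivity) |>.2
  nlinarith [norm_nonneg (qft (fun x => (u x : ℍ)) y),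
    sq_nonneg ‖𝓕 (fun x => (u x : ℂ)) (reflect y)‖]

/-- Both bounds pass from `f` to `π ∘ f`, the second one in terms of the complex Fourier transform.
Here `π` stands for one of the four coordinate functions of `ℍ`. -/
theorem decay_component {f : Plane → ℍ} (hf : AEStronglyMeasurable f) {d α β C : ℝ} (hα : 0 < α)
    (hC : 0 ≤ C)
    (hle : ∀ᵐ x, ‖f x‖ ≤ C * (1 + ‖x‖) ^ d * Real.exp (-(Real.pi * α * ‖x‖ ^ 2)))
    {π : ℍ → ℝ} (hπc : Continuous π) (hπ : ∀ q, |π q| ≤ ‖q‖)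
    (hle' : ∀ᵐ y : Plane, ‖qft (fun x => (π (f x) : ℍ)) y‖ ≤
      C * (1 + ‖y‖) ^ d * Real.exp (-(Real.pi * β * ‖y‖ ^ 2))) :
    AEStronglyMeasurable (fun x => π (f x)) ∧
    (∀ᵐ x, |π (f x)| ≤ 2 * C * (1 + ‖x‖) ^ d * Real.exp (-(Real.pi * α * ‖x‖ ^ 2))) ∧
    ∀ᵐ y, ‖𝓕 (fun x => ((π (f x) : ℝ) : ℂ)) y‖ ≤
      2 * C * (1 + ‖y‖) ^ d * Real.exp (-(Real.pi * β * ‖y‖ ^ 2)) := by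
  have hm : AEStronglyMeasurable (fun x => π (f x)) := hπc.comp_aestronglyMeasurable hf
  have hb : ∀ᵐ x, |π (f x)| ≤ C * (1 + ‖x‖) ^ d * Real.exp (-(Real.pi * α * ‖x‖ ^ 2)) := by
    filter_upwards [hle] with x hx using (hπ _).trans hx
  refine ⟨hm, ?_, ?_⟩
  · filter_upwards [hb] with x hx
    refine hx.trans ?_
    gcongr
    linarith
  · filter_upwards [hle'] with y hy
    exact (norm_fourier_le_of_qft_le (integrable_of_norm_le_weight hm (mul_pos Real.pi_pos hα) hb)
      hy).trans_eq (by ring)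

theorem abs_components_le (q : ℍ) :
    |q.re| ≤ ‖q‖ ∧ |q.imI| ≤ ‖q‖ ∧ |q.imJ| ≤ ‖q‖ ∧ |q.imK| ≤ ‖q‖ := by
  have h := quaternion_norm_sq q
  refine ⟨?_, ?_, ?_, ?_⟩ <;>
  · refine abs_le_of_sq_le_sq ?_ (norm_nonneg q)
    nlinarith [sq_nonneg q.re, sq_nonneg q.imI, sq_nonneg q.imJ, sq_nonneg q.imK]

theorem norm_qft_components_le (f : Plane → ℍ) (y : Plane) :
    ‖qft (fun x => ((f x).re : ℍ)) y‖ ≤ qftModulus f y ∧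
    ‖qft (fun x => ((f x).imI : ℍ)) y‖ ≤ qftModulus f y ∧
    ‖qft (fun x => ((f x).imJ : ℍ)) y‖ ≤ qftModulus f y ∧
    ‖qft (fun x => ((f x).imK : ℍ)) y‖ ≤ qftModulus f y := by
  refine ⟨?_, ?_, ?_, ?_⟩ <;>
  · refine Real.le_sqrt_of_sq_le ?_
    nlinarith [sq_nonneg ‖qft (fun x => ((f x).re : ℍ)) y‖,
      sq_nonneg ‖qft (fun x => ((f x).imI : ℍ)) y‖,
      sq_nonneg ‖qft (fun x => ((f x).imJ : ℍ)) y‖,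
      sq_nonneg ‖qft (fun x => ((f x).imK : ℍ)) y‖]

/-- A statement about real functions subject to the two decay conditions holds for the four
components of a function satisfying `HardyDecay`. -/
theorem HardyDecay.components {d α β : ℝ} (hα : 0 < α) {f : L2} (hf : HardyDecay d α β f)
    {Q : (Plane → ℝ) → Prop}
    (hQ : ∀ (u : Plane → ℝ) (C : ℝ), 0 ≤ C → AEStronglyMeasurable u →
      (∀ᵐ x, |u x| ≤ C * (1 + ‖x‖) ^ d * Real.exp (-(Real.pi * α * ‖x‖ ^ 2))) →
      (∀ᵐ y, ‖𝓕 (fun x => (u x : ℂ)) y‖ ≤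
        C * (1 + ‖y‖) ^ d * Real.exp (-(Real.pi * β * ‖y‖ ^ 2))) → Q u) :
    Q (fun x => (f x).re) ∧ Q (fun x => (f x).imI) ∧ Q (fun x => (f x).imJ) ∧
      Q (fun x => (f x).imK) := by
  obtain ⟨C, hC, hle, hle'⟩ := hf
  have key : ∀ π : ℍ → ℝ, Continuous π → (∀ q, |π q| ≤ ‖q‖) →
      (∀ y, ‖qft (fun x => (π (f x) : ℍ)) y‖ ≤ qftModulus f y) → Q (fun x => π (f x)) := by
    intro π hπc hπ hπq
    obtain ⟨h1, h2, h3⟩ := decay_component (Lp.aestronglyMeasurable f) hα hC.le hle hπc hπ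
      (β := β) (by filter_upwards [hle'] with y hy using (hπq y).trans hy)
    exact hQ _ _ (by positivity) h1 h2 h3
  exact ⟨key _ Quaternion.continuous_re (fun q => (abs_components_le q).1)
      fun y => (norm_qft_components_le f y).1,
    key _ Quaternion.continuous_imI (fun q => (abs_components_le q).2.1)
      fun y => (norm_qft_components_le f y).2.1,
    key _ Quaternion.continuous_imJ (fun q => (abs_components_le q).2.2.1)
      fun y => (norm_qft_components_le f y).2.2.1,
    key _ Quaternion.continuous_imK (fun q => (abs_components_le q).2.2.2)
      fun y => (norm_qft_components_le f y).2.2.2⟩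

/-! ### Gaussians -/

/-- The Gaussian `e^{-πγ|x|²}`. -/
noncomputable def gaussian (γ : ℝ) (x : Plane) : ℝ := Real.exp (-(Real.pi * γ * ‖x‖ ^ 2))

theorem continuous_gaussian (γ : ℝ) : Continuous (gaussian γ) := by
  unfold gaussian
  fun_prop

theorem memLp_gaussian {γ : ℝ} (hγ : 0 < γ) :
    MemLp (fun x : Plane => (gaussian γ x : ℍ)) 2 := by
  have hm : AEStronglyMeasurable (fun x : Plane => (gaussian γ x : ℍ)) :=
    (Quaternion.continuous_coe.comp (continuous_gaussian γ)).aestronglyMeasurable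
  rw [memLp_two_iff_integrable_sq_norm hm]
  refine (integrable_exp_neg_mul_sq_norm (V := Plane) (a := 2 * (Real.pi * γ))
    (by positivity)).congr (Eventually.of_forall fun x => ?_)
  change _ = ‖(gaussian γ x : ℍ)‖ ^ 2
  rw [Quaternion.norm_coe, gaussian, Real.norm_eq_abs, sq_abs, ← Real.exp_nat_mul]
  refine congrArg Real.exp ?_
  push_cast
  ring

theorem norm_fourier_gaussian {γ : ℝ} (hγ : 0 < γ) (y : Plane) :
    ‖𝓕 (fun x => (gaussian γ x : ℂ)) y‖ = γ⁻¹ * Real.exp (-(Real.pi * γ⁻¹ * ‖y‖ ^ 2)) := by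
  have hb : 0 < ((Real.pi * γ : ℝ) : ℂ).re := by
    rw [Complex.ofReal_re]
    positivity
  have h := fourier_gaussian_innerProductSpace (V := Plane) hb y
  have hfun : (fun x => (gaussian γ x : ℂ)) =
      fun v : Plane => Complex.exp (-((Real.pi * γ : ℝ) : ℂ) * ‖v‖ ^ 2) := by
    ext x
    rw [gaussian]
    push_cast
    ring_nf
  rw [hfun, h, norm_mul, Complex.norm_exp]
  have hπ := Real.pi_pos.ne'
  congr 1
  · have h2 : (((Module.finrank ℝ Plane : ℕ) : ℂ) / 2) = 1 := by simp
    rw [h2, Complex.cpow_one, ← Complex.ofReal_div, Complex.norm_real,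
      Real.norm_of_nonneg (by positivity)]
    field_simp
  · congr 1
    have : (-(Real.pi : ℂ) ^ 2 * (‖y‖ : ℂ) ^ 2 / ((Real.pi * γ : ℝ) : ℂ)) =
        ((-(Real.pi * γ⁻¹ * ‖y‖ ^ 2) : ℝ) : ℂ) := by
      push_cast
      field_simp
    rw [this, Complex.ofReal_re]

theorem qft_congr_ae {f g : Plane → ℍ} (h : f =ᵐ[volume] g) (y : Plane) : qft f y = qft g y := by
  refine integral_congr_ae ?_
  filter_upwards [h] with x hx
  simp only [hx]

theorem qftModulus_congr_ae {f g : Plane → ℍ} (h : f =ᵐ[volume] g) (y : Plane) :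
    qftModulus f y = qftModulus g y := by
  have hcongr : ∀ π : ℍ → ℝ, qft (fun x => (π (f x) : ℍ)) y = qft (fun x => (π (g x) : ℍ)) y :=
    fun π => qft_congr_ae (h.fun_comp fun q => (π q : ℍ)) y
  have h0 := hcongr fun q => q.re
  have h1 := hcongr fun q => q.imI
  have h2 := hcongr fun q => q.imJ
  have h3 := hcongr fun q => q.imK
  simp only [qftModulus, h0, h1, h2, h3]

theorem qftModulus_ofReal (u : Plane → ℝ) (y : Plane) :
    qftModulus (fun x => (u x : ℍ)) y = ‖qft (fun x => (u x : ℍ)) y‖ := by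
  have h0 : qft (fun _ => ((0 : ℝ) : ℍ)) y = 0 := by simp [qft]
  simp only [qftModulus, Quaternion.re_coe, Quaternion.imI_coe, Quaternion.imJ_coe,
    Quaternion.imK_coe, h0]
  simp

theorem hardyDecay_gaussian {d α β γ : ℝ} (hd : 0 ≤ d) (hγ : 0 < γ) (hαγ : α ≤ γ) (hβγ : β ≤ γ⁻¹) :
    HardyDecay d α β (memLp_gaussian hγ).toLp := by
  have hone : ∀ x : Plane, 1 ≤ (1 + ‖x‖) ^ d := fun x =>
    Real.one_le_rpow (by linarith [norm_nonneg x]) hd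
  refine ⟨max 1 γ⁻¹, by positivity, ?_, Eventually.of_forall fun y => ?_⟩
  · filter_upwards [(memLp_gaussian hγ).coeFn_toLp] with x hx
    rw [hx, Quaternion.norm_coe, gaussian, Real.norm_of_nonneg (Real.exp_nonneg _)]
    calc Real.exp (-(Real.pi * γ * ‖x‖ ^ 2)) ≤ 1 * 1 * Real.exp (-(Real.pi * α * ‖x‖ ^ 2)) := by
          rw [one_mul, one_mul]
          gcongr
      _ ≤ _ := by
          gcongr
          · exact le_max_left _ _
          · exact hone x
  · have hint : Integrable (gaussian γ) := integrable_exp_neg_mul_sq_norm (by positivity)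
    have hq : ‖qft (fun x => (gaussian γ x : ℍ)) y‖ =
        γ⁻¹ * Real.exp (-(Real.pi * γ⁻¹ * ‖y‖ ^ 2)) := by
      rw [← sq_eq_sq₀ (norm_nonneg _) (by positivity), norm_sq_qft hint, norm_fourier_gaussian hγ,
        norm_fourier_gaussian hγ, norm_reflect]
      ring
    rw [qftModulus_congr_ae (memLp_gaussian hγ).coeFn_toLp, qftModulus_ofReal, hq]
    calc γ⁻¹ * Real.exp (-(Real.pi * γ⁻¹ * ‖y‖ ^ 2)) ≤
          γ⁻¹ * 1 * Real.exp (-(Real.pi * β * ‖y‖ ^ 2)) := by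
          rw [mul_one]
          gcongr
      _ ≤ _ := by
          gcongr
          · exact le_max_right _ _
          · exact hone y

theorem mul_coe_components (q : ℍ) (a : ℝ) :
    (q * (a : ℍ)).re = q.re * a ∧ (q * (a : ℍ)).imI = q.imI * a ∧
      (q * (a : ℍ)).imJ = q.imJ * a ∧ (q * (a : ℍ)).imK = q.imK * a := by
  simp

/-- Gaussians of distinct widths are independent: their values on the spheres `‖x‖ ^ 2 = k`,
`k ∈ ℕ`, are powers `r ^ k` with distinct bases `r`, that is distinct characters of `ℕ`. -/
theorem linearIndependent_gaussian {γ : ℕ → ℝ} (hγ : ∀ n, 0 < γ n) (hinj : Function.Injective γ) :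
    LinearIndependent ℍ fun n => (memLp_gaussian (hγ n)).toLp := by
  rw [linearIndependent_iff']
  intro s c hsum i hi
  have hae : (fun x : Plane => ∑ n ∈ s, c n * (gaussian (γ n) x : ℍ)) =ᵐ[volume] fun _ => 0 := by
    have h1 := Lp.coeFn_fun_finsetSum s fun n => c n • (memLp_gaussian (hγ n)).toLp
    rw [hsum] at h1
    have h2 : ∀ᵐ x : Plane, ∀ n, (c n • (memLp_gaussian (hγ n)).toLp : L2) x =
        c n * (gaussian (γ n) x : ℍ) := by
      rw [ae_all_iff]
      intro n
      filter_upwards [Lp.coeFn_smul (c n) (memLp_gaussian (hγ n)).toLp,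
        (memLp_gaussian (hγ n)).coeFn_toLp] with x hx hx'
      rw [hx, Pi.smul_apply, hx', smul_eq_mul]
    filter_upwards [h1, h2, Lp.coeFn_zero ℍ 2 (volume : Measure Plane)] with x hx hx' hx''
    rw [hx''] at hx
    simp only [hx'] at hx
    exact hx.symm
  have hcont : Continuous fun x : Plane => ∑ n ∈ s, c n * (gaussian (γ n) x : ℍ) :=
    continuous_finsetSum _ fun n _ =>
      continuous_const.mul (Quaternion.continuous_coe.comp (continuous_gaussian _))
  have hall := (hcont.ae_eq_iff_eq volume continuous_const).1 hae
  let r : ℕ → ℝ := fun n => Real.exp (-(Real.pi * γ n))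
  have hr : Function.Injective r := fun m n hmn => by
    have := Real.exp_injective hmn
    exact hinj (mul_left_cancel₀ Real.pi_pos.ne' (neg_injective this))
  have hpow : ∀ k : ℕ, ∑ n ∈ s, c n * ((r n ^ k : ℝ) : ℍ) = 0 := by
    intro k
    -- A point of the sphere `‖x‖ ^ 2 = k`.
    have := congrFun hall (EuclideanSpace.single 0 (Real.sqrt k))
    rw [← this]
    refine Finset.sum_congr rfl fun n _ => ?_
    congr 2
    rw [gaussian, PiLp.norm_single, Real.norm_of_nonneg (Real.sqrt_nonneg _),
      Real.sq_sqrt (Nat.cast_nonneg k), ← Real.exp_nat_mul]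
    congr 1
    ring
  have hind : LinearIndependent ℝ fun n : ℕ => (powersHom ℝ (r n) : Multiplicative ℕ → ℝ) :=
    (linearIndependent_monoidHom (Multiplicative ℕ) ℝ).comp (fun n => powersHom ℝ (r n))
      ((powersHom ℝ).injective.comp hr)
  rw [linearIndependent_iff'] at hind
  have hreal : ∀ a : ℕ → ℝ, (∀ k : ℕ, ∑ n ∈ s, a n * r n ^ k = 0) → a i = 0 := by
    intro a ha
    refine hind s a ?_ i hi
    ext k
    simpa [powersHom_apply] using ha k.toAdd
  have hcomp : ∀ φ : ℍ →+ ℝ, (∀ (q : ℍ) (a : ℝ), φ (q * (a : ℍ)) = φ q * a) → φ (c i) = 0 := by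
    intro φ hφ
    refine hreal (fun n => φ (c n)) fun k => ?_
    have := congrArg φ (hpow k)
    rw [map_sum, map_zero] at this
    simpa only [hφ] using this
  exact Quaternion.ext _ _
    (hcomp (AddMonoidHom.mk' (fun q => q.re) fun _ _ => rfl) fun q a => (mul_coe_components q a).1)
    (hcomp (AddMonoidHom.mk' (fun q => q.imI) fun _ _ => rfl) fun q a => (mul_coe_components q a).2.1)
    (hcomp (AddMonoidHom.mk' (fun q => q.imJ) fun _ _ => rfl) fun q a => (mul_coe_components q a).2.2.1)
    (hcomp (AddMonoidHom.mk' (fun q => q.imK) fun _ _ => rfl) fun q a => (mul_coe_components q a).2.2.2)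

end QFT

theorem corollary5p1 (d α β : ℝ) (hd : 0 ≤ d) (hα : 0 < α) (hβ : 0 < β) :
    (1 < α * β → ∀ f : QFT.L2, QFT.HardyDecay d α β f → f = 0) ∧
    (α * β = 1 → ∀ f : QFT.L2, QFT.HardyDecay d α β f →
      ∃ P : QFT.QPoly, (QFT.QPoly.degree P : ℝ) ≤ d ∧
        ∀ᵐ x : QFT.Plane,
          f x = Real.exp (-(Real.pi * α * ‖x‖ ^ 2)) • QFT.QPoly.eval P x) ∧
    (α * β < 1 → ∃ g : ℕ → QFT.L2,
      LinearIndependent ℍ g ∧ ∀ n : ℕ, QFT.HardyDecay d α β (g n)) := by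
  refine ⟨fun hαβ f hf => ?_, fun hαβ f hf => ?_, fun hαβ => ?_⟩
  · obtain ⟨h0, h1, h2, h3⟩ := hf.components hα (Q := fun u => u =ᵐ[volume] 0)
      fun u C hC hu hle hle' => QFT.ae_eq_zero_of_decay hu hd hβ hαβ hC hle hle'
    rw [Lp.eq_zero_iff_ae_eq_zero]
    filter_upwards [h0, h1, h2, h3] with x h0 h1 h2 h3
    exact Quaternion.ext _ _ h0 h1 h2 h3
  · obtain ⟨⟨P0, hP0, h0⟩, ⟨P1, hP1, h1⟩, ⟨P2, hP2, h2⟩, ⟨P3, hP3, h3⟩⟩ :=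
      hf.components hα (Q := fun u => ∃ P : MvPolynomial (Fin 2) ℝ, (P.totalDegree : ℝ) ≤ d ∧
        ∀ᵐ x : QFT.Plane, u x =
          Real.exp (-(Real.pi * α * ‖x‖ ^ 2)) * MvPolynomial.eval (fun i => x i) P)
      fun u C hC hu hle hle' =>
        QFT.exists_ae_eq_gaussian_mul_polynomial_degree_le hu hd hα hβ hαβ hC hle hle'
    refine ⟨⟨P0, P1, P2, P3⟩, ?_, ?_⟩
    · simp only [QFT.QPoly.degree, Nat.cast_max]
      exact max_le (max_le hP0 hP1) (max_le hP2 hP3)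
    · filter_upwards [h0, h1, h2, h3] with x h0 h1 h2 h3
      exact Quaternion.ext _ _ h0 h1 h2 h3
  · have hlt : α < β⁻¹ := by rwa [lt_inv_comm₀ hα hβ, ← one_div, lt_div_iff₀ hα, mul_comm]
    have hδ : 0 < β⁻¹ - α := sub_pos.2 hlt
    let γ : ℕ → ℝ := fun n => α + (β⁻¹ - α) / (n + 1)
    have hαγ : ∀ n, α ≤ γ n := fun n => by
      have : 0 ≤ (β⁻¹ - α) / (n + 1) := by positivity
      exact le_add_of_nonneg_right this
    have hγ : ∀ n, 0 < γ n := fun n => hα.trans_le (hαγ n)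
    have hγβ : ∀ n, γ n ≤ β⁻¹ := fun n => by
      have : (β⁻¹ - α) / (n + 1) ≤ β⁻¹ - α :=
        div_le_self hδ.le (by linarith [Nat.cast_nonneg (α := ℝ) n])
      simp only [γ]
      linarith
    have hinj : Function.Injective γ := fun m n hmn => by
      have h1 := add_left_cancel hmn
      rw [div_eq_div_iff (by positivity) (by positivity)] at h1
      have h2 := mul_left_cancel₀ hδ.ne' h1
      exact_mod_cast (add_right_cancel h2).symm
    exact ⟨fun n => (QFT.memLp_gaussian (hγ n)).toLp, QFT.linearIndependent_gaussian hγ hinj,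
      fun n => QFT.hardyDecay_gaussian hd (hγ n) (hαγ n)
        (le_inv_of_le_inv₀ (hγ n) (hγβ n))⟩
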